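/- For natural numbers $m,n\ge 1$, identify the vertices of the grid graph $P_m\times P_n$ with the set $V=\{(i,j) : 1\le i\le m,\ 1\le j\le n\}$, and let $d((i_1,j_1),(i_2,j_2))=|i_1-i_2|+|j_1-j_2|$ be the Manhattan distance. Let $$M(P_m\times P_n)=\max_{\sigma}\ \sum_{t=1}^{mn-1} d\bigl(\sigma^{-1}(t),\sigma^{-1}(t+1)\bigr),$$ where $\sigma$ ranges over all bijections $V\to\{1,2,\ldots,mn\}$. Assume that $m,n\geq 3$. Then: 1. If $m$ and $n$ are both even, then $M(P_m\times P_n)\in\{r,r+1\}$, where $r=\frac{mn(m+n)}{2}-3$. 2. If $m$ and $n$ are both odd, then $M(P_m\times P_n)\in\{r,r+1\}$, where $r=\frac{mn(m+n)}{2}-\frac{m+n}{2}-1$. 3. If $m$ is odd and $n$ is even, then $M(P_m\times P_n)=\frac{mn(m+n)}{2}-\frac{n}{2}-1$. Furthermore, for every $n\geq 2$, we have $M(P_2\times P_n)\in\{r,r+1\}$, where $r=(n+1)^2-4$. In particular, the values for the $n\times n$ grid conjectured by McNeil are exact up to an additive constant of $1$: for every $n\ge 2$, $M(P_n\times P_n)\in\{n^3-3,\,n^3-2\}$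 if $n$ is even, and $M(P_n\times P_n)\in\{n^3-n-1,\,n^3-n\}$ if $n$ is odd. -/

import Mathlib

/-- The Manhattan distance `|i₁ - i₂| + |j₁ - j₂|` between two vertices of the `m × n` grid, whose
vertex set is `Fin m × Fin n`. -/
def manhattanDist {m n : ℕ} (u v : Fin m × Fin n) : ℤ :=
  |((u.1 : ℕ) : ℤ) - ((v.1 : ℕ) : ℤ)| + |((u.2 : ℕ) : ℤ) - ((v.2 : ℕ) : ℤ)|

/-- The total Manhattan length of the walk induced by a bijective labeling `σ` of the `m × n` grid.
The labels `1, …, mn` are shifted to `0, …, mn - 1`; the walk visits the vertices in the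
order of their labels and has `mn - 1` steps. -/
def walkLength {m n : ℕ} (σ : Fin m × Fin n ≃ Fin (m * n)) : ℤ :=
  ∑ t : Fin (m * n - 1),
    manhattanDist (σ.symm ⟨(t : ℕ), by omega⟩) (σ.symm ⟨(t : ℕ) + 1, by omega⟩)

/-- `maxWalkLength m n` is `M(P_m × P_n)`: the maximum, over all bijective labelings of the `m × n`
grid, of the length of the induced walk. -/
def maxWalkLength (m n : ℕ) : ℤ :=
  Finset.univ.sup' ⟨finProdFinEquiv, Finset.mem_univ _⟩
    (walkLength : (Fin m × Fin n ≃ Fin (m * n)) → ℤ)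

/-!
Double the coordinates and move the origin to the centre of the grid. The distance of two points is
at most the sum of their norms, with equality exactly when the points lie in opposite closed
quadrants; call the difference of the two sides the excess. Twice the length of a Hamiltonian path
is then `2 * ∑ ‖p‖` minus the norms of the two ends and the excesses of the steps. The excesses are
nonnegative and the norms of the ends are bounded below by parity, which gives the upper bounds.

For the lower bounds, a path alternating between a sector (an open quadrant or half-axis) and its
negative has no excess. Such zigzags exhaust the grid, and they can be joined without excess except
when both sides are even: then there are no half-axes, and the single step from one diagonal pair
of quadrants to the other has excess two.
-/

section HamiltonianPath

variable {α β M : Type*}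

/-- The sum of `f` over the pairs of consecutive entries of a list. -/
def pathSum [AddMonoid M] (f : α → α → M) : List α → M
  | [] => 0
  | [_] => 0
  | x :: y :: l => f x y + pathSum f (y :: l)

theorem pathSum_append [AddMonoid M] (f : α → α → M) {l l' : List α} {x y : α}
    (hx : x ∈ l.getLast?) (hy : y ∈ l'.head?) :
    pathSum f (l ++ l') = pathSum f l + f x y + pathSum f l' := by
  obtain ⟨l', rfl⟩ := List.head?_eq_some_iff.1 hy
  induction l with
  | nil => simp at hx
  | cons a l ih =>
    cases l with
    | nil => simp_all [pathSum]
    | cons b l => simp_all [pathSum, add_assoc]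

theorem pathSum_map [AddMonoid M] (f : β → β → M) (e : α → β) (l : List α) :
    pathSum f (l.map e) = pathSum (fun x y => f (e x) (e y)) l := by
  induction l using List.twoStepInduction <;> simp_all [pathSum]

theorem pathSum_ofFn [AddCommMonoid M] (f : α → α → M) {N : ℕ} (g : Fin N → α) :
    pathSum f (List.ofFn g) =
      ∑ t : Fin (N - 1), f (g ⟨t, by omega⟩) (g ⟨t + 1, by omega⟩) := by
  induction N using Nat.twoStepInduction with
  | zero => simp [pathSum]
  | one => simp [pathSum]
  | more N _ ih =>
    have ih := ih fun i => g i.succ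
    rw [List.ofFn_succ] at ih
    rw [List.ofFn_succ, List.ofFn_succ, pathSum, ih]
    exact (Fin.sum_univ_succ (n := N)
      fun t : Fin (N + 1) => f (g ⟨t, by omega⟩) (g ⟨t + 1, by omega⟩)).symm

theorem pathSum_nonneg [AddMonoid M] [Preorder M] [AddLeftMono M] {f : α → α → M}
    (hf : ∀ x y, 0 ≤ f x y) (l : List α) : 0 ≤ pathSum f l := by
  induction l using List.twoStepInduction with
  | nil => exact le_rfl
  | singleton => exact le_rfl
  | cons_cons x y l _ ih => exact add_nonneg (hf x y) (ih y)

theorem pathSum_add_sub [AddCommGroup M] (w : α → M) (f : α → α → M) {l : List α} {x y : α}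
    (hx : x ∈ l.head?) (hy : y ∈ l.getLast?) :
    pathSum (fun a b => w a + w b - f a b) l =
      2 • (l.map w).sum - w x - w y - pathSum f l := by
  induction l generalizing x with
  | nil => simp at hx
  | cons a l ih =>
    cases l with
    | nil =>
      obtain rfl : a = x := by simpa using hx
      obtain rfl : a = y := by simpa using hy
      simp [pathSum, two_nsmul]
    | cons b l =>
      obtain rfl : a = x := by simpa using hx
      rw [pathSum, pathSum, ih rfl (by simpa using hy)]
      simp only [List.map_cons, List.sum_cons]
      abel

/-- `HasHamPath f s x y c` says that some path from `x` to `y` which visits every element of `s`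
exactly once, and nothing else, has total cost `c`, where a step from `a` to `b` costs `f a b`. -/
def HasHamPath [AddMonoid M] (f : α → α → M) (s : Finset α) (x y : α) (c : M) : Prop :=
  ∃ l : List α, l.Nodup ∧ (∀ a, a ∈ l ↔ a ∈ s) ∧ x ∈ l.head? ∧ y ∈ l.getLast? ∧ pathSum f l = c

theorem hasHamPath_singleton [AddMonoid M] (f : α → α → M) (x : α) : HasHamPath f {x} x x 0 :=
  ⟨[x], by simp [pathSum]⟩

theorem HasHamPath.mem_left [AddMonoid M] {f : α → α → M} {s : Finset α} {x y : α} {c : M}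
    (h : HasHamPath f s x y c) : x ∈ s := by
  obtain ⟨l, -, hl, hx, -⟩ := h
  exact (hl x).1 (List.mem_of_mem_head? hx)

theorem HasHamPath.mem_right [AddMonoid M] {f : α → α → M} {s : Finset α} {x y : α} {c : M}
    (h : HasHamPath f s x y c) : y ∈ s := by
  obtain ⟨l, -, hl, -, hy, -⟩ := h
  exact (hl y).1 (List.mem_of_getLast? hy)

theorem HasHamPath.nonneg [AddMonoid M] [Preorder M] [AddLeftMono M] {f : α → α → M}
    {s : Finset α} {x y : α} {c : M} (h : HasHamPath f s x y c) (hf : ∀ a b, 0 ≤ f a b) :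
    0 ≤ c := by
  obtain ⟨l, -, -, -, -, rfl⟩ := h
  exact pathSum_nonneg hf l

theorem HasHamPath.append [DecidableEq α] [AddMonoid M] {f : α → α → M} {s t : Finset α}
    {x y x' y' : α} {c c' : M} (h : HasHamPath f s x y c) (h' : HasHamPath f t x' y' c')
    (hst : Disjoint s t) : HasHamPath f (s ∪ t) x y' (c + f y x' + c') := by
  obtain ⟨l, hl, hls, hx, hy, rfl⟩ := h
  obtain ⟨l', hl', hlt, hx', hy', rfl⟩ := h'
  refine ⟨l ++ l', ?_, fun a => by simp [hls, hlt], ?_, ?_, pathSum_append f hy hx'⟩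
  · exact hl.append hl' fun a ha ha' =>
      Finset.disjoint_left.1 hst ((hls a).1 ha) ((hlt a).1 ha')
  · simp [Option.mem_def.1 hx]
  · simp [Option.mem_def.1 hy']

theorem HasHamPath.add_sub [AddCommGroup M] {f : α → α → M} {s : Finset α} {x y : α} {c : M}
    (h : HasHamPath f s x y c) (w : α → M) :
    HasHamPath (fun a b => w a + w b - f a b) s x y (2 • ∑ a ∈ s, w a - w x - w y - c) := by
  classical
  obtain ⟨l, hl, hls, hx, hy, rfl⟩ := h
  obtain rfl : l.toFinset = s := by ext a; simp [hls]
  exact ⟨l, hl, hls, hx, hy, by rw [pathSum_add_sub w f hx hy, List.sum_toFinset w hl]⟩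

theorem hasHamPath_union_of_card_eq [DecidableEq α] [AddMonoid M] {f : α → α → M}
    {s t : Finset α} (hcard : s.card = t.card) (hst : Disjoint s t)
    (hf : ∀ a ∈ s, ∀ b ∈ t, f a b = 0 ∧ f b a = 0) {x y : α} (hx : x ∈ s) (hy : y ∈ t) :
    HasHamPath f (s ∪ t) x y 0 := by
  obtain ⟨k, hk⟩ := Nat.exists_eq_add_one.2 (Finset.card_pos.2 ⟨x, hx⟩)
  induction k generalizing s t x with
  | zero =>
    obtain ⟨a, rfl⟩ := Finset.card_eq_one.1 hk
    obtain ⟨b, rfl⟩ := Finset.card_eq_one.1 (hcard ▸ hk)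
    obtain rfl := Finset.eq_of_mem_singleton hx
    obtain rfl := Finset.eq_of_mem_singleton hy
    simpa only [(hf x hx y hy).1, add_zero] using
      (hasHamPath_singleton f x).append (hasHamPath_singleton f y) hst
  | succ k ih =>
    have hks {a} (ha : a ∈ s) : (s.erase a).card = k + 1 := by
      rw [Finset.card_erase_of_mem ha, hk, Nat.add_sub_cancel]
    have hkt {a} (ha : a ∈ t) : (t.erase a).card = k + 1 := by
      rw [Finset.card_erase_of_mem ha, ← hcard, hk, Nat.add_sub_cancel]
    obtain ⟨x', hx'⟩ : (s.erase x).Nonempty := Finset.card_pos.1 (hks hx ▸ k.succ_pos)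
    obtain ⟨y', hy'⟩ : (t.erase y).Nonempty := Finset.card_pos.1 (hkt hy ▸ k.succ_pos)
    obtain ⟨hyy', hy't⟩ := Finset.mem_erase.1 hy'
    have hx's := Finset.mem_of_mem_erase hx'
    have hrest : HasHamPath f (s.erase x ∪ t.erase y') x' y 0 :=
      ih (by rw [hks hx, hkt hy't])
        (hst.mono (Finset.erase_subset _ _) (Finset.erase_subset _ _))
        (fun a ha b hb => hf a (Finset.mem_of_mem_erase ha) b (Finset.mem_of_mem_erase hb))
        hx' (Finset.mem_erase.2 ⟨hyy'.symm, hy⟩) (hks hx)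
    have hxt := Finset.disjoint_left.1 hst hx
    have hy's := Finset.disjoint_right.1 hst hy't
    have hpath := ((hasHamPath_singleton f x).append (hasHamPath_singleton f y')
      (Finset.disjoint_singleton.2 fun h => hxt (h ▸ hy't))).append hrest
        (by simp [hxt, hy's])
    rw [Finset.union_union_union_comm, ← Finset.insert_eq, ← Finset.insert_eq,
      Finset.insert_erase hx, Finset.insert_erase hy't] at hpath
    simpa only [(hf x hx y' hy't).1, (hf x' hx's y' hy't).2, add_zero] using hpath

end HamiltonianPath

/-- The taxicab norm on `ℤ × ℤ`. -/
def taxicab (p : ℤ × ℤ) : ℤ := |p.1| + |p.2|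

/-- The defect in the triangle inequality `taxicab (p - q) ≤ taxicab p + taxicab q`: the amount by
which a step from `p` to `q` falls short of the sum of the norms of its ends. -/
def excess (p q : ℤ × ℤ) : ℤ := taxicab p + taxicab q - taxicab (p - q)

theorem excess_nonneg (p q : ℤ × ℤ) : 0 ≤ excess p q := by
  have h₁ := abs_sub p.1 q.1
  have h₂ := abs_sub p.2 q.2
  simp only [excess, taxicab, Prod.fst_sub, Prod.snd_sub]
  linarith

theorem abs_sub_eq_add_of_mul_nonpos {a b : ℤ} (h : a * b ≤ 0) : |a - b| = |a| + |b| := by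
  rcases mul_nonpos_iff.1 h with h | h <;> grind

theorem excess_eq_zero {p q : ℤ × ℤ} (h₁ : p.1 * q.1 ≤ 0) (h₂ : p.2 * q.2 ≤ 0) :
    excess p q = 0 := by
  simp only [excess, taxicab, Prod.fst_sub, Prod.snd_sub, abs_sub_eq_add_of_mul_nonpos h₁,
    abs_sub_eq_add_of_mul_nonpos h₂]
  ring

section Axis

variable {m : ℕ}

/-- The coordinate `i` of a grid of side `m`, doubled and centred at the origin. -/
def axisEmb (m : ℕ) : Fin m ↪ ℤ where
  toFun i := 2 * (i : ℕ) - (m - 1)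
  inj' := by
    intro i j h
    exact Fin.ext (by simpa using h)

theorem axisEmb_apply (i : Fin m) : axisEmb m i = 2 * (i : ℕ) - (m - 1) := rfl

/-- The integers of absolute value less than `m` and parity opposite to `m`: the centred
coordinates on one side of a grid. -/
def axis (m : ℕ) : Finset ℤ := Finset.univ.map (axisEmb m)

theorem mem_axis {x : ℤ} : x ∈ axis m ↔ -m < x ∧ x < m ∧ (x + m) % 2 = 1 := by
  simp only [axis, Finset.mem_map, Finset.mem_univ, true_and, axisEmb_apply]
  constructor
  · rintro ⟨i, rfl⟩
    omega
  · rintro ⟨h₁, h₂, h₃⟩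
    exact ⟨⟨((x + m - 1) / 2).toNat, by lia⟩, by lia⟩

theorem card_axis : (axis m).card = m := by simp [axis]

theorem axis_add_two (m : ℕ) :
    axis (m + 2) = insert ((m : ℤ) + 1) (insert (-((m : ℤ) + 1)) (axis m)) := by
  ext x
  simp only [Finset.mem_insert, mem_axis]
  lia

theorem two_mul_sum_abs_axis (m : ℕ) : 2 * ∑ x ∈ axis m, |x| = (m : ℤ) ^ 2 - m % 2 := by
  induction m using Nat.twoStepInduction with
  | zero => rfl
  | one => rfl
  | more m ih _ =>
    rw [axis_add_two, Finset.sum_insert (by simp only [Finset.mem_insert, mem_axis]; lia),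
      Finset.sum_insert (by simp [mem_axis]), abs_neg, abs_of_nonneg (by lia), ← add_assoc,
      mul_add, ih]
    push_cast
    rw [Int.add_emod_right]
    ring

end Axis

section Grid

variable {m n : ℕ}

/-- The vertices of the `m × n` grid in doubled coordinates centred at the origin. The doubling
makes them integral. -/
def grid (m n : ℕ) : Finset (ℤ × ℤ) := axis m ×ˢ axis n

/-- The position of a vertex in doubled centred coordinates. -/
def centre : Fin m × Fin n ↪ ℤ × ℤ := (axisEmb m).prodMap (axisEmb n)

theorem map_univ_centre : Finset.univ.map (centre (m := m) (n := n)) = grid m n := by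
  rw [← Finset.univ_product_univ, centre, Finset.prodMap_map_product]
  rfl

theorem taxicab_centre_sub_centre (u v : Fin m × Fin n) :
    taxicab (centre u - centre v) = 2 * manhattanDist u v := by
  simp only [taxicab, centre, manhattanDist, Function.Embedding.coe_prodMap, axisEmb_apply,
    Prod.map, Prod.fst_sub, Prod.snd_sub]
  grind

theorem mem_grid {p : ℤ × ℤ} : p ∈ grid m n ↔ p.1 ∈ axis m ∧ p.2 ∈ axis n :=
  Finset.mem_product

theorem two_mul_sum_taxicab (m n : ℕ) :
    2 * ∑ p ∈ grid m n, taxicab p = n * ((m : ℤ) ^ 2 - m % 2) + m * ((n : ℤ) ^ 2 - n % 2) := by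
  simp only [grid, taxicab, Finset.sum_product, Finset.sum_add_distrib, Finset.sum_const, card_axis,
    ← Finset.mul_sum, nsmul_eq_mul, ← two_mul_sum_abs_axis]
  ring

theorem le_taxicab_of_mem_grid {p : ℤ × ℤ} (hp : p ∈ grid m n) :
    2 - (m : ℤ) % 2 - (n : ℤ) % 2 ≤ taxicab p := by
  simp only [mem_grid, mem_axis] at hp
  have h₁ : 1 - (m : ℤ) % 2 ≤ |p.1| := by grind
  have h₂ : 1 - (n : ℤ) % 2 ≤ |p.2| := by grind
  rw [taxicab]
  lia

end Grid

section Sector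

variable {m n : ℕ} {p q s t : ℤ × ℤ}

/-- The vertices of the grid whose coordinates have the signs `s.1` and `s.2`: for `s` with entries
in `{-1, 0, 1}`, the centre, an open half-axis or an open quadrant. -/
def sector (m n : ℕ) (s : ℤ × ℤ) : Finset (ℤ × ℤ) :=
  {q ∈ grid m n | q.1.sign = s.1 ∧ q.2.sign = s.2}

theorem mem_sector : q ∈ sector m n s ↔ q ∈ grid m n ∧ q.1.sign = s.1 ∧ q.2.sign = s.2 :=
  Finset.mem_filter

theorem neg_mem_grid : -p ∈ grid m n ↔ p ∈ grid m n := by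
  simp only [mem_grid, mem_axis, Prod.fst_neg, Prod.snd_neg]
  lia

theorem neg_mem_sector_neg : -q ∈ sector m n (-s) ↔ q ∈ sector m n s := by
  simp only [mem_sector, neg_mem_grid, Prod.fst_neg, Prod.snd_neg, Int.sign_neg, neg_inj]

theorem card_sector_neg (m n : ℕ) (s : ℤ × ℤ) : (sector m n (-s)).card = (sector m n s).card :=
  Finset.card_equiv (Equiv.neg _) fun q => by
    rw [Equiv.neg_apply, ← neg_mem_sector_neg, neg_neg]

theorem disjoint_sector (hst : s ≠ t) : Disjoint (sector m n s) (sector m n t) := by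
  refine Finset.disjoint_left.2 fun q hs ht => hst ?_
  obtain ⟨-, hs₁, hs₂⟩ := mem_sector.1 hs
  obtain ⟨-, ht₁, ht₂⟩ := mem_sector.1 ht
  exact Prod.ext (hs₁.symm.trans ht₁) (hs₂.symm.trans ht₂)

theorem excess_eq_zero_of_mem_sector (hp : p ∈ sector m n s) (hq : q ∈ sector m n (-s)) :
    excess p q = 0 := by
  have mul_nonpos_of_sign {a b c : ℤ} (ha : a.sign = c) (hb : b.sign = -c) : a * b ≤ 0 := by
    rw [← Int.sign_nonpos_iff, Int.sign_mul, ha, hb, mul_neg]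
    exact neg_nonpos.2 (mul_self_nonneg c)
  obtain ⟨-, hp₁, hp₂⟩ := mem_sector.1 hp
  obtain ⟨-, hq₁, hq₂⟩ := mem_sector.1 hq
  exact excess_eq_zero (mul_nonpos_of_sign hp₁ hq₁) (mul_nonpos_of_sign hp₂ hq₂)

/-- The union of two opposite sectors, between which every step has excess zero. -/
def doubleSector (m n : ℕ) (s : ℤ × ℤ) : Finset (ℤ × ℤ) := sector m n s ∪ sector m n (-s)

theorem mem_doubleSector : q ∈ doubleSector m n s ↔ q ∈ sector m n s ∨ q ∈ sector m n (-s) :=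
  Finset.mem_union

theorem disjoint_doubleSector (h : s ≠ t) (h' : s ≠ -t) :
    Disjoint (doubleSector m n s) (doubleSector m n t) := by
  simp only [doubleSector, Finset.disjoint_union_left, Finset.disjoint_union_right]
  exact ⟨⟨disjoint_sector h, disjoint_sector (neg_eq_iff_eq_neg.not.2 h')⟩,
    disjoint_sector h', disjoint_sector (neg_injective.ne h)⟩

theorem hasHamPath_doubleSector (hs : s ≠ 0) (hp : p ∈ sector m n s) :
    HasHamPath excess (doubleSector m n s) p (-p) 0 :=
  hasHamPath_union_of_card_eq (card_sector_neg m n s).symm (disjoint_sector (self_ne_neg.2 hs))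
    (fun _ ha _ hb => ⟨excess_eq_zero_of_mem_sector ha hb,
      excess_eq_zero_of_mem_sector hb (by rwa [neg_neg])⟩)
    hp (neg_mem_sector_neg.2 hp)

theorem HasHamPath.append_doubleSector {r : Finset (ℤ × ℤ)} {x y : ℤ × ℤ} {c : ℤ}
    (h : HasHamPath excess r x y c) (hs : s ≠ 0) (hp : p ∈ sector m n s)
    (hr : Disjoint r (doubleSector m n s)) :
    HasHamPath excess (r ∪ doubleSector m n s) x (-p) (c + excess y p) := by
  simpa only [add_zero] using h.append (hasHamPath_doubleSector hs hp) hr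

theorem hasHamPath_erase_sector (hs : s ≠ 0) {x x' y y' : ℤ × ℤ} (hx : x ∈ sector m n s)
    (hx' : x' ∈ sector m n s) (hxx' : x ≠ x') (hy : y ∈ sector m n (-s))
    (hy' : y' ∈ sector m n (-s)) (hyy' : y ≠ y') :
    HasHamPath excess ((sector m n s).erase x' ∪ (sector m n (-s)).erase y') x y 0 := by
  refine hasHamPath_union_of_card_eq ?_
    ((disjoint_sector (self_ne_neg.2 hs)).mono (Finset.erase_subset _ _) (Finset.erase_subset _ _))
    (fun a ha b hb => ?_) (Finset.mem_erase.2 ⟨hxx', hx⟩) (Finset.mem_erase.2 ⟨hyy', hy⟩)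
  · rw [Finset.card_erase_of_mem hx', Finset.card_erase_of_mem hy', card_sector_neg]
  · have ha := Finset.mem_of_mem_erase ha
    have hb := Finset.mem_of_mem_erase hb
    exact ⟨excess_eq_zero_of_mem_sector ha hb, excess_eq_zero_of_mem_sector hb (by rwa [neg_neg])⟩

end Sector

section MaxWalkLength

variable {m n : ℕ}

theorem hasHamPath_walkLength (hm : 0 < m) (hn : 0 < n) (σ : Fin m × Fin n ≃ Fin (m * n)) :
    ∃ p q, HasHamPath (fun p q => taxicab (p - q)) (grid m n) p q (2 * walkLength σ) := by
  set l := (List.ofFn σ.symm).map centre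
  have hl : l ≠ [] := by simpa [l] using ⟨hm.ne', hn.ne'⟩
  refine ⟨l.head hl, l.getLast hl, l, ?_, fun p => ?_, List.head_mem_head? hl,
    List.getLast_mem_getLast? hl, ?_⟩
  · exact (List.nodup_ofFn.2 σ.symm.injective).map centre.injective
  · simp only [l, ← map_univ_centre, List.mem_map, Finset.mem_map, List.mem_ofFn,
      Finset.mem_univ, σ.symm.surjective _]
  · simp only [l, pathSum_map, pathSum_ofFn, taxicab_centre_sub_centre, walkLength, Finset.mul_sum]

theorem exists_two_mul_walkLength_eq {p q : ℤ × ℤ} {L : ℤ}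
    (h : HasHamPath (fun p q => taxicab (p - q)) (grid m n) p q L) :
    ∃ σ : Fin m × Fin n ≃ Fin (m * n), 2 * walkLength σ = L := by
  obtain ⟨l, hl, hmem, -, -, rfl⟩ := h
  obtain ⟨l, rfl⟩ : ∃ l' : List (Fin m × Fin n), l'.map centre = l := by
    rw [← Set.mem_range, Set.range_list_map]
    exact fun p hp => by simpa [← map_univ_centre] using (hmem p).1 hp
  replace hl := hl.of_map
  replace hmem (v : Fin m × Fin n) : v ∈ l := by
    simpa using (hmem (centre v)).2 (by simp [← map_univ_centre])
  have hlen : l.length = m * n := by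
    simpa using Fintype.card_congr (hl.getEquivOfForallMemList l hmem)
  let σ : Fin (m * n) ≃ Fin m × Fin n :=
    (finCongr hlen.symm).trans (hl.getEquivOfForallMemList l hmem)
  have hσ : l = List.ofFn σ := List.ext_getElem (by simp [hlen]) (by simp [σ])
  refine ⟨σ.symm, ?_⟩
  simp only [hσ, pathSum_map, pathSum_ofFn, taxicab_centre_sub_centre, walkLength, Finset.mul_sum,
    Equiv.symm_symm]

theorem maxWalkLength_le (hm : 0 < m) (hn : 0 < n) :
    maxWalkLength m n ≤ ∑ p ∈ grid m n, taxicab p - (2 - (m : ℤ) % 2 - (n : ℤ) % 2) := by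
  refine Finset.sup'_le _ _ fun σ _ => ?_
  obtain ⟨p, q, h⟩ := hasHamPath_walkLength hm hn σ
  have hexcess : 0 ≤ 2 • ∑ a ∈ grid m n, taxicab a - taxicab p - taxicab q - 2 * walkLength σ :=
    (h.add_sub taxicab).nonneg excess_nonneg
  have hp := le_taxicab_of_mem_grid h.mem_left
  have hq := le_taxicab_of_mem_grid h.mem_right
  lia

theorem le_maxWalkLength {p q : ℤ × ℤ} {k : ℤ} (h : HasHamPath excess (grid m n) p q k) :
    2 * ∑ p ∈ grid m n, taxicab p - taxicab p - taxicab q - k ≤ 2 * maxWalkLength m n := by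
  have h' := h.add_sub taxicab
  simp only [excess, sub_sub_cancel] at h'
  obtain ⟨σ, hσ⟩ := exists_two_mul_walkLength_eq h'
  have hle : walkLength σ ≤ maxWalkLength m n := Finset.le_sup' _ (Finset.mem_univ σ)
  lia

end MaxWalkLength

section Constructions

variable {m n : ℕ}

theorem hasHamPath_grid_of_even_of_even (hm : Even m) (hn : Even n) (hm0 : 0 < m) (hn0 : 0 < n) :
    HasHamPath excess (grid m n) (1, 1) (1, -1) 2 := by
  have hmem {x : ℤ} (hx : x = 1 ∨ x = -1) : (x, 1) ∈ grid m n := by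
    simp only [mem_grid, mem_axis]
    grind
  have h₁ : (1, 1) ∈ sector m n (1, 1) := mem_sector.2 ⟨hmem (by simp), rfl, rfl⟩
  have h₂ : (-1, 1) ∈ sector m n (-1, 1) := mem_sector.2 ⟨hmem (by simp), rfl, rfl⟩
  have h := (hasHamPath_doubleSector (by decide) h₁).append_doubleSector (by decide) h₂
    (disjoint_doubleSector (by decide) (by decide))
  have hcover : doubleSector m n (1, 1) ∪ doubleSector m n (-1, 1) = grid m n := by
    ext ⟨x, y⟩
    simp only [Finset.mem_union, mem_doubleSector, mem_sector, mem_grid, mem_axis, Prod.neg_mk,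
      neg_neg, Int.sign_eq_one_iff_pos, Int.sign_eq_neg_one_iff_neg]
    grind
  rwa [hcover] at h

theorem hasHamPath_grid_of_odd_of_odd (hm : Odd m) (hn : Odd n) (hm3 : 3 ≤ m) (hn3 : 3 ≤ n) :
    HasHamPath excess (grid m n) (0, 0) (0, 2) 0 := by
  have hmem {x y : ℤ} (hx : x = 0 ∨ x = 2) (hy : y = -2 ∨ y = 0 ∨ y = 2) :
      (x, y) ∈ grid m n := by
    simp only [mem_grid, mem_axis]
    grind
  have h₁ : (2, 2) ∈ sector m n (1, 1) := mem_sector.2 ⟨hmem (by simp) (by simp), rfl, rfl⟩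
  have h₂ : (2, 0) ∈ sector m n (1, 0) := mem_sector.2 ⟨hmem (by simp) (by simp), rfl, rfl⟩
  have h₃ : (2, -2) ∈ sector m n (1, -1) := mem_sector.2 ⟨hmem (by simp) (by simp), rfl, rfl⟩
  have h₄ : (0, -2) ∈ sector m n (0, -1) := mem_sector.2 ⟨hmem (by simp) (by simp), rfl, rfl⟩
  have h := hasHamPath_singleton excess (0, 0)
    |>.append_doubleSector (by decide) h₁ (by simp [mem_doubleSector, mem_sector])
    |>.append_doubleSector (by decide) h₂ (by
      simp [mem_doubleSector, mem_sector, disjoint_doubleSector])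
    |>.append_doubleSector (by decide) h₃ (by
      simp [mem_doubleSector, mem_sector, disjoint_doubleSector])
    |>.append_doubleSector (by decide) h₄ (by
      simp [mem_doubleSector, mem_sector, disjoint_doubleSector])
  have hcover : {(0, 0)} ∪ doubleSector m n (1, 1) ∪ doubleSector m n (1, 0) ∪
      doubleSector m n (1, -1) ∪ doubleSector m n (0, -1) = grid m n := by
    ext ⟨x, y⟩
    simp only [Finset.mem_union, Finset.mem_singleton, Prod.mk.injEq, mem_doubleSector, mem_sector,
      mem_grid, mem_axis, Prod.neg_mk, neg_neg, neg_zero, Int.sign_eq_one_iff_pos,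
      Int.sign_eq_neg_one_iff_neg, Int.sign_eq_zero_iff_zero]
    grind
  rwa [hcover] at h

theorem hasHamPath_grid_two_of_odd (hn : Odd n) (hn3 : 3 ≤ n) :
    HasHamPath excess (grid 2 n) (1, 0) (-1, 2) 0 := by
  have hmem {x : ℤ} (hx : x = 1 ∨ x = -1) : (x, -2) ∈ grid 2 n := by
    simp only [mem_grid, mem_axis]
    grind
  have h₁ : (-1, -2) ∈ sector 2 n (-1, -1) := mem_sector.2 ⟨hmem (by simp), rfl, rfl⟩
  have h₂ : (1, -2) ∈ sector 2 n (1, -1) := mem_sector.2 ⟨hmem (by simp), rfl, rfl⟩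
  -- The axis point `(-1, 0)` makes the change between the two pairs of opposite quadrants free.
  have h := hasHamPath_singleton excess (1, 0)
    |>.append_doubleSector (by decide) h₁ (by simp [mem_doubleSector, mem_sector])
    |>.append (hasHamPath_singleton excess (-1, 0)) (by simp [mem_doubleSector, mem_sector])
    |>.append_doubleSector (by decide) h₂ (by
      simp [mem_doubleSector, mem_sector, disjoint_doubleSector])
  have hcover : {(1, 0)} ∪ doubleSector 2 n (-1, -1) ∪ {(-1, 0)} ∪ doubleSector 2 n (1, -1) =
      grid 2 n := by
    ext ⟨x, y⟩
    simp only [Finset.mem_union, Finset.mem_singleton, Prod.mk.injEq, mem_doubleSector, mem_sector,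
      mem_grid, mem_axis, Prod.neg_mk, neg_neg, Int.sign_eq_one_iff_pos,
      Int.sign_eq_neg_one_iff_neg]
    grind
  rwa [hcover] at h

theorem hasHamPath_grid_of_odd_of_even (hm : Odd m) (hn : Even n) (hm3 : 3 ≤ m) (hn3 : 3 ≤ n) :
    HasHamPath excess (grid m n) (0, 1) (0, -1) 0 := by
  have hmem {x y : ℤ} (hx : x = -2 ∨ x = 0) (hy : y = -3 ∨ y = -1 ∨ y = 1 ∨ y = 3) :
      (x, y) ∈ grid m n := by
    simp only [mem_grid, mem_axis]
    grind
  have h₁ : (-2, -1) ∈ sector m n (-1, -1) := mem_sector.2 ⟨hmem (by simp) (by simp), rfl, rfl⟩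
  have h₂ : (-2, 1) ∈ sector m n (-1, 1) := mem_sector.2 ⟨hmem (by simp) (by simp), rfl, rfl⟩
  have haxis {y z : ℤ} (hy : y = -3 ∨ y = -1 ∨ y = 1 ∨ y = 3) (hyz : y.sign = z) :
      (0, y) ∈ sector m n (0, z) := mem_sector.2 ⟨hmem (by simp) hy, rfl, hyz⟩
  have h₃ : HasHamPath excess
      ((sector m n (0, 1)).erase (0, 1) ∪ (sector m n (0, -1)).erase (0, -3)) (0, 3) (0, -1) 0 :=
    hasHamPath_erase_sector (by decide) (haxis (by simp) rfl) (haxis (by simp) rfl) (by decide)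
      (haxis (by simp) rfl) (haxis (by simp) rfl) (by decide)
  -- The axis point `(0, -3)` makes the change between the two pairs of opposite quadrants free.
  have h := hasHamPath_singleton excess (0, 1)
    |>.append_doubleSector (by decide) h₁ (by simp [mem_doubleSector, mem_sector])
    |>.append (hasHamPath_singleton excess (0, -3)) (by simp [mem_doubleSector, mem_sector])
    |>.append_doubleSector (by decide) h₂ (by
      simp [mem_doubleSector, mem_sector, disjoint_doubleSector])
    |>.append h₃ (by
      simp only [Finset.disjoint_left, Finset.mem_union, Finset.mem_singleton, Finset.mem_erase,
        mem_doubleSector, mem_sector, Prod.neg_mk]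
      grind)
  have hcover : {(0, 1)} ∪ doubleSector m n (-1, -1) ∪ {(0, -3)} ∪ doubleSector m n (-1, 1) ∪
      ((sector m n (0, 1)).erase (0, 1) ∪ (sector m n (0, -1)).erase (0, -3)) = grid m n := by
    ext ⟨x, y⟩
    simp only [Finset.mem_union, Finset.mem_singleton, Finset.mem_erase, ne_eq, Prod.mk.injEq,
      mem_doubleSector, mem_sector, mem_grid, mem_axis, Prod.neg_mk, neg_neg,
      Int.sign_eq_one_iff_pos, Int.sign_eq_neg_one_iff_neg, Int.sign_eq_zero_iff_zero]
    grind
  rwa [hcover] at h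

end Constructions

section Bounds

variable {m n : ℕ}

theorem two_mul_maxWalkLength_of_even_of_even (hm : Even m) (hn : Even n) (hm0 : 0 < m)
    (hn0 : 0 < n) :
    2 * maxWalkLength m n = m * n * (m + n) - 6 ∨ 2 * maxWalkLength m n = m * n * (m + n) - 4 := by
  have hm2 : (m : ℤ) % 2 = 0 := by exact_mod_cast Nat.even_iff.1 hm
  have hn2 : (n : ℤ) % 2 = 0 := by exact_mod_cast Nat.even_iff.1 hn
  have hsum : 2 * ∑ p ∈ grid m n, taxicab p = m * n * (m + n) := by
    rw [two_mul_sum_taxicab, hm2, hn2]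
    ring
  have hle := maxWalkLength_le hm0 hn0
  have hge := le_maxWalkLength (hasHamPath_grid_of_even_of_even hm hn hm0 hn0)
  rw [show taxicab (1, 1) = 2 from rfl, show taxicab (1, -1) = 2 from rfl] at hge
  lia

theorem two_mul_maxWalkLength_of_odd_of_odd (hm : Odd m) (hn : Odd n) (hm3 : 3 ≤ m)
    (hn3 : 3 ≤ n) :
    2 * maxWalkLength m n = m * n * (m + n) - (m + n) - 2 ∨
      2 * maxWalkLength m n = m * n * (m + n) - (m + n) := by
  have hm2 : (m : ℤ) % 2 = 1 := by exact_mod_cast Nat.odd_iff.1 hm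
  have hn2 : (n : ℤ) % 2 = 1 := by exact_mod_cast Nat.odd_iff.1 hn
  have hsum : 2 * ∑ p ∈ grid m n, taxicab p = m * n * (m + n) - (m + n) := by
    rw [two_mul_sum_taxicab, hm2, hn2]
    ring
  have hle := maxWalkLength_le (m := m) (n := n) (by lia) (by lia)
  have hge := le_maxWalkLength (hasHamPath_grid_of_odd_of_odd hm hn hm3 hn3)
  rw [show taxicab (0, 0) = 0 from rfl, show taxicab (0, 2) = 2 from rfl] at hge
  lia

theorem two_mul_maxWalkLength_of_odd_of_even (hm : Odd m) (hn : Even n) (hm3 : 3 ≤ m)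
    (hn3 : 3 ≤ n) : 2 * maxWalkLength m n = m * n * (m + n) - n - 2 := by
  have hm2 : (m : ℤ) % 2 = 1 := by exact_mod_cast Nat.odd_iff.1 hm
  have hn2 : (n : ℤ) % 2 = 0 := by exact_mod_cast Nat.even_iff.1 hn
  have hsum : 2 * ∑ p ∈ grid m n, taxicab p = m * n * (m + n) - n := by
    rw [two_mul_sum_taxicab, hm2, hn2]
    ring
  have hle := maxWalkLength_le (m := m) (n := n) (by lia) (by lia)
  have hge := le_maxWalkLength (hasHamPath_grid_of_odd_of_even hm hn hm3 hn3)
  rw [show taxicab (0, 1) = 1 from rfl, show taxicab (0, -1) = 1 from rfl] at hge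
  lia

theorem maxWalkLength_two_of_odd (hn : Odd n) (hn3 : 3 ≤ n) :
    maxWalkLength 2 n = ((n : ℤ) + 1) ^ 2 - 4 ∨ maxWalkLength 2 n = ((n : ℤ) + 1) ^ 2 - 3 := by
  have hn2 : (n : ℤ) % 2 = 1 := by exact_mod_cast Nat.odd_iff.1 hn
  have hsum : 2 * ∑ p ∈ grid 2 n, taxicab p = 2 * ((n : ℤ) + 1) ^ 2 - 4 := by
    rw [two_mul_sum_taxicab, hn2]
    push_cast
    ring
  have hle := maxWalkLength_le (m := 2) (n := n) two_pos (by lia)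
  have hge := le_maxWalkLength (hasHamPath_grid_two_of_odd hn hn3)
  rw [show taxicab (1, 0) = 1 from rfl, show taxicab (-1, 2) = 3 from rfl] at hge
  lia

theorem maxWalkLength_two (hn : 2 ≤ n) :
    maxWalkLength 2 n = ((n : ℤ) + 1) ^ 2 - 4 ∨ maxWalkLength 2 n = ((n : ℤ) + 1) ^ 2 - 3 := by
  rcases n.even_or_odd with hn' | hn'
  · exact (two_mul_maxWalkLength_of_even_of_even even_two hn' two_pos (by lia)).imp
      (fun h => by push_cast at h; linarith) (fun h => by push_cast at h; linarith)
  · exact maxWalkLength_two_of_odd hn' (by grind)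

end Bounds

theorem theorem1 :
    (∀ m n : ℕ, 3 ≤ m → 3 ≤ n →
      (Even m → Even n →
        (maxWalkLength m n : ℚ) ∈
          ({(m * n * (m + n) / 2 - 3 : ℚ), (m * n * (m + n) / 2 - 3 + 1 : ℚ)} : Set ℚ)) ∧
      (Odd m → Odd n →
        (maxWalkLength m n : ℚ) ∈
          ({(m * n * (m + n) / 2 - (m + n) / 2 - 1 : ℚ),
            (m * n * (m + n) / 2 - (m + n) / 2 - 1 + 1 : ℚ)} : Set ℚ)) ∧
      (Odd m → Even n →
        (maxWalkLength m n : ℚ) = (m * n * (m + n) / 2 - n / 2 - 1 : ℚ))) ∧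
    (∀ n : ℕ, 2 ≤ n →
      maxWalkLength 2 n ∈ ({((n : ℤ) + 1) ^ 2 - 4, ((n : ℤ) + 1) ^ 2 - 4 + 1} : Set ℤ)) ∧
    (∀ n : ℕ, 2 ≤ n →
      (Even n → maxWalkLength n n ∈ ({(n : ℤ) ^ 3 - 3, (n : ℤ) ^ 3 - 3 + 1} : Set ℤ)) ∧
      (Odd n → maxWalkLength n n ∈ ({(n : ℤ) ^ 3 - n - 1, (n : ℤ) ^ 3 - n - 1 + 1} : Set ℤ))) := by
  simp only [Set.mem_insert_iff, Set.mem_singleton_iff]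
  refine ⟨fun m n hm3 hn3 => ⟨fun hm hn => ?_, fun hm hn => ?_, fun hm hn => ?_⟩,
    fun n hn2 => ?_, fun n hn2 => ⟨fun hn => ?_, fun hn => ?_⟩⟩
  · exact (two_mul_maxWalkLength_of_even_of_even hm hn (by lia) (by lia)).imp
      (fun h => by qify at h; linarith) (fun h => by qify at h; linarith)
  · exact (two_mul_maxWalkLength_of_odd_of_odd hm hn hm3 hn3).imp
      (fun h => by qify at h; linarith) (fun h => by qify at h; linarith)
  · have h := two_mul_maxWalkLength_of_odd_of_even hm hn hm3 hn3
    qify at h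
    linarith
  · exact (maxWalkLength_two hn2).imp_right fun h => by linarith
  · exact (two_mul_maxWalkLength_of_even_of_even hn hn (by lia) (by lia)).imp
      (fun h => by linarith) (fun h => by linarith)
  · have hn3 : 3 ≤ n := by grind
    exact (two_mul_maxWalkLength_of_odd_of_odd hn hn hn3 hn3).imp
      (fun h => by linarith) (fun h => by linarith)
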